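/- Let $K$ be an algebraically closed subfield of $\mathbb{C}$ of finite transcendence degree over $\mathbb{Q}$ with $\pi\in K$. Call a tuple $b_1,\dots,b_n$ of complex numbers linearly independent over $\sqrt{-1}\,\pi$ if $\sqrt{-1}\,\pi,b_1,\dots,b_n$ are $\mathbb{Q}$-linearly independent. Let $a_1,\dots,a_s\in K$ be linearly independent over $\sqrt{-1}\,\pi$, and let $$\Gamma^*=\{g\in\mathbb{C}^\times : g^n\in[\exp(a_1),\dots,\exp(a_s)]\text{ for some } n\geq 1\},$$ where $[A]$ denotes the subgroup of $\mathbb{C}^\times$ generated by $A$. Let $\mathbb{U}\subseteq\mathbb{C}^\times$ be the group of all roots of unity, and let $L\subseteq\mathbb{C}$ be a finitely generated field extension of $\mathbb{Q}(\mathbb{U})$ containing $\exp(a_1),\dots,\exp(a_s)$. Then there are $t'\in\mathbb{N}$ and $c_1,\dots,c_{t'}\in K$, linearly independent over $\sqrt{-1}\,\pi$, such that for every $k$ and all $\lambda_1,\dots,\lambda_k\in L$ the following holds: if $x_1,\dots,x_k\in\Gamma^*$ satisfy $\lambda_1x_1+\cdots+\lambda_kx_k=1$ and $\sum_{i\in I}\lambda_ix_i\neq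 0$ for every nonempty proper subset $I\subset\{1,\dots,k\}$, then each $x_i$ lies in $\mathbb{U}\cdot[\exp(c_1),\dots,\exp(c_{t'})]$. -/

import Mathlib

/-- The exponential of a complex number, as an element of `ℂˣ`. -/
noncomputable def expUnit (z : ℂ) : ℂˣ :=
  Units.mk0 (Complex.exp z) (Complex.exp_ne_zero z)

/-- The group `𝕌` of all complex roots of unity. -/
def rootsOfUnityGroup : Subgroup ℂˣ := CommGroup.torsion ℂˣ

/-- The field `ℚ(𝕌)`, as a subfield of `ℂ`. -/
noncomputable def cyclotomicClosure : IntermediateField ℚ ℂ :=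
  IntermediateField.adjoin ℚ ((fun u : ℂˣ => (u : ℂ)) '' (rootsOfUnityGroup : Set ℂˣ))

/-- The smallest radical subgroup `⟨A⟩` of an abelian group `G` containing `A`: all `g` with
`g ^ n` in the subgroup generated by `A` for some `n > 0`. -/
def radicalHull {G : Type*} [CommGroup G] (A : Set G) : Subgroup G where
  carrier := {g | ∃ n : ℕ, 0 < n ∧ g ^ n ∈ Subgroup.closure A}
  one_mem' := ⟨1, one_pos, by simp⟩
  mul_mem' := by
    rintro a b ⟨m, hm, ha⟩ ⟨n, hn, hb⟩
    refine ⟨m * n, Nat.mul_pos hm hn, ?_⟩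
    rw [mul_pow, pow_mul, mul_comm m n, pow_mul]
    exact mul_mem (pow_mem ha n) (pow_mem hb m)
  inv_mem' := by
    rintro a ⟨m, hm, ha⟩
    refine ⟨m, hm, ?_⟩
    rw [inv_pow]
    exact inv_mem ha

/-- The tuple `a` is linearly independent over `√-1 π`, i.e. `√-1 π, a₁, …, aₙ` are
`ℚ`-linearly independent. -/
def LinearIndependentOverIPi {n : ℕ} (a : Fin n → ℂ) : Prop :=
  LinearIndependent ℚ (Fin.cons (Complex.I * (Real.pi : ℂ)) a : Fin (n + 1) → ℂ)

/-- `x` is a non-degenerate solution of `l₁ x₁ + ⋯ + lₖ xₖ = 1`. -/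
def IsNondegenerateSolution {k : ℕ} (l : Fin k → ℂ) (x : Fin k → ℂˣ) : Prop :=
  ∑ i, l i * (x i : ℂ) = 1 ∧
    ∀ J : Finset (Fin k), J.Nonempty → J ≠ Finset.univ → ∑ i ∈ J, l i * (x i : ℂ) ≠ 0

/-! Since `L` contains all roots of unity, the Galois group of the algebraic closure of `L` in `ℂ`
multiplies each `x i` by a character. Linear independence of characters splits the equation by
character, and nondegeneracy leaves only the trivial one, so every `x i` lies in `L`
(`IsNondegenerateSolution.mem_range_algebraMap`).

Next, `L` lies in `F(𝕌)` for some `F` finitely generated over `ℚ`. As `F(𝕌)/F` is abelian, Kummer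
theory gives a uniform `w` with `x ^ w ∈ 𝕌 · Fˣ` (`pow_mem_range_sup_rootsOfUnity`). Inside `F` the
radical of a finitely generated group is finitely generated (`fg_radicalHull`), by a Northcott
argument: specialisation at integer points bounds the minimal polynomials of its reduced elements,
leaving finitely many.

Finally, the `ℚ`-span of the `a i` avoids `√-1 π`, so `exp` is injective on it modulo `𝕌`. The
admissible logarithms therefore form a lattice of finite rank, and a `ℤ`-basis of it is the required
`c` (`exists_linearIndependentOverIPi_generators`). -/

/-! ### Integral polynomials of bounded growth -/

/-- The real function `H` on the lattice `ℤ^σ` is bounded by a power of `1 + ∑ τᵢ²`. -/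
def HasPolynomialGrowth {σ : Type*} [Fintype σ] (H : (σ → ℤ) → ℝ) : Prop :=
  ∃ C D : ℕ, ∀ τ, H τ ≤ C * (1 + ∑ i, (τ i : ℝ) ^ 2) ^ D

namespace HasPolynomialGrowth

variable {σ : Type*} [Fintype σ] {H H' : (σ → ℤ) → ℝ}

lemma one_le_weight (τ : σ → ℤ) : (1 : ℝ) ≤ 1 + ∑ i, (τ i : ℝ) ^ 2 :=
  le_add_of_nonneg_right (Finset.sum_nonneg fun _ _ => sq_nonneg _)

lemma mono (h : HasPolynomialGrowth H) (hle : ∀ τ, H' τ ≤ H τ) : HasPolynomialGrowth H' := by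
  obtain ⟨C, D, hCD⟩ := h
  exact ⟨C, D, fun τ => (hle τ).trans (hCD τ)⟩

lemma const (c : ℝ) : HasPolynomialGrowth (fun _ : σ → ℤ => c) := by
  obtain ⟨n, hn⟩ := exists_nat_ge c
  exact ⟨n, 0, fun τ => by simpa using hn⟩

lemma add (h : HasPolynomialGrowth H) (h' : HasPolynomialGrowth H') :
    HasPolynomialGrowth (fun τ => H τ + H' τ) := by
  obtain ⟨C, D, hCD⟩ := h
  obtain ⟨C', D', hCD'⟩ := h'
  refine ⟨C + C', D + D', fun τ => ?_⟩
  have hw := one_le_weight τ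
  push_cast
  rw [add_mul]
  gcongr
  · refine (hCD τ).trans ?_
    gcongr
    omega
  · refine (hCD' τ).trans ?_
    gcongr
    omega

lemma mul (h : HasPolynomialGrowth H) (h' : HasPolynomialGrowth H') (hH' : ∀ τ, 0 ≤ H' τ) :
    HasPolynomialGrowth (fun τ => H τ * H' τ) := by
  obtain ⟨C, D, hCD⟩ := h
  obtain ⟨C', D', hCD'⟩ := h'
  refine ⟨C * C', D + D', fun τ => ?_⟩
  have hw := one_le_weight τ
  calc H τ * H' τ ≤ (C * (1 + ∑ i, (τ i : ℝ) ^ 2) ^ D) * (C' * (1 + ∑ i, (τ i : ℝ) ^ 2) ^ D') :=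
        mul_le_mul (hCD τ) (hCD' τ) (hH' τ) (by positivity)
    _ = _ := by push_cast; ring

lemma pow (h : HasPolynomialGrowth H) (hH : ∀ τ, 0 ≤ H τ) (n : ℕ) :
    HasPolynomialGrowth (fun τ => H τ ^ n) := by
  induction n with
  | zero => simpa using const 1
  | succ n ih => simpa only [pow_succ] using ih.mul h hH

lemma sum {ι : Type*} (s : Finset ι) {H : ι → (σ → ℤ) → ℝ}
    (h : ∀ i ∈ s, HasPolynomialGrowth (H i)) : HasPolynomialGrowth (fun τ => ∑ i ∈ s, H i τ) := by
  classical
  induction s using Finset.induction_on with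
  | empty => simpa using const 0
  | insert a s ha ih =>
    simp only [Finset.sum_insert ha]
    exact (h a (by simp)).add (ih fun i hi => h i (by simp [hi]))

lemma prod {ι : Type*} (s : Finset ι) {H : ι → (σ → ℤ) → ℝ}
    (h : ∀ i ∈ s, HasPolynomialGrowth (H i)) (hH : ∀ i τ, 0 ≤ H i τ) :
    HasPolynomialGrowth (fun τ => ∏ i ∈ s, H i τ) := by
  classical
  induction s using Finset.induction_on with
  | empty => simpa using const 1
  | insert a s ha ih =>
    simp only [Finset.prod_insert ha]
    exact (h a (by simp)).mul (ih fun i hi => h i (by simp [hi]))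
      fun τ => Finset.prod_nonneg fun i _ => hH i τ

lemma abs_eval (P : MvPolynomial σ ℤ) :
    HasPolynomialGrowth (fun τ => |((MvPolynomial.eval τ P : ℤ) : ℝ)|) := by
  induction P using MvPolynomial.induction_on with
  | C a => simpa using const |(a : ℝ)|
  | add p q hp hq => exact (hp.add hq).mono fun τ => by simpa using abs_add_le _ _
  | mul_X p i hp =>
    have hX : HasPolynomialGrowth (fun τ : σ → ℤ => |(τ i : ℝ)|) := by
      refine ⟨1, 1, fun τ => ?_⟩
      have h1 : (τ i : ℝ) ^ 2 ≤ ∑ i, (τ i : ℝ) ^ 2 :=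
        Finset.single_le_sum (f := fun i => (τ i : ℝ) ^ 2) (fun _ _ => sq_nonneg _)
          (Finset.mem_univ i)
      rw [← sq_abs] at h1
      simp only [Nat.cast_one, one_mul, pow_one]
      nlinarith [sq_nonneg (|(τ i : ℝ)| - 1), abs_nonneg (τ i : ℝ)]
    exact (hp.mul hX fun _ => abs_nonneg _).mono fun τ => by simp [abs_mul]

end HasPolynomialGrowth

namespace MvPolynomial

section

variable {σ : Type*}

/-- The restriction of a polynomial to the line through the origin and `v`. -/
noncomputable def restrictLine (v : σ → ℤ) (P : MvPolynomial σ ℤ) : Polynomial ℤ :=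
  aeval (fun i => Polynomial.C (v i) * Polynomial.X) P

lemma eval_restrictLine (v : σ → ℤ) (P : MvPolynomial σ ℤ) (m : ℤ) :
    (restrictLine v P).eval m = eval (fun i => v i * m) P := by
  induction P using MvPolynomial.induction_on <;> simp_all [restrictLine]

/-- Reduces bounds on the total degree to growth in one variable. -/
lemma coeff_restrictLine (v : σ → ℤ) (P : MvPolynomial σ ℤ) (k : ℕ) :
    (restrictLine v P).coeff k = eval v (homogeneousComponent k P) := by
  classical
  induction P using MvPolynomial.induction_on' with
  | monomial u a =>
    have h1 : restrictLine v (monomial u a) =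
        Polynomial.C (a * u.prod fun i e => v i ^ e) * Polynomial.X ^ u.degree := by
      simp only [restrictLine, aeval_monomial, mul_pow, Finsupp.prod, Finset.prod_mul_distrib,
        Finset.prod_pow_eq_pow_sum, Finsupp.degree_apply]
      simp [mul_assoc]
    rw [h1, Polynomial.coeff_C_mul_X_pow, homogeneousComponent_apply]
    by_cases hk : k = u.degree
    · by_cases ha : a = 0
      · simp [ha]
      · rw [if_pos hk, Finset.filter_true_of_mem]
        · rw [support_monomial, if_neg ha, Finset.sum_singleton,
            coeff_monomial, if_pos rfl, eval_monomial]
        · intro d hd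
          rw [support_monomial, if_neg ha, Finset.mem_singleton] at hd
          rw [hd, hk]
    · rw [if_neg hk, Finset.filter_false_of_mem]
      · simp
      · intro d hd
        have := support_monomial_subset hd
        rw [Finset.mem_singleton] at this
        rw [this]; exact fun h => hk h.symm
  | add p q hp hq =>
    rw [map_add, map_add, ← hp, ← hq, restrictLine, restrictLine, restrictLine, map_add,
      Polynomial.coeff_add]

end

variable {σ : Type*} [Fintype σ]

/-- A polynomial with integral coefficients whose values on `ℤ^σ` are bounded by the `D`-th power
of the quadratic weight has degree at most `2 * D`. -/
lemma totalDegree_le_of_growth {P : MvPolynomial σ ℤ} {C D : ℕ}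
    (h : ∀ τ, |((eval τ P : ℤ) : ℝ)| ≤ C * (1 + ∑ i, (τ i : ℝ) ^ 2) ^ D) : P.totalDegree ≤ 2 * D := by
  have key : ∀ k, 2 * D < k → homogeneousComponent k P = 0 := by
    intro k hk
    refine MvPolynomial.funext fun v => ?_
    rw [← coeff_restrictLine, map_zero]
    apply Polynomial.coeff_eq_zero_of_natDegree_lt
    refine lt_of_le_of_lt ?_ hk
    by_contra! hlt
    -- `Q` is the growth bound along the line. A restriction of degree above `2 * D` could stay
    -- below `Q` at only finitely many integers.
    set Q : Polynomial ℤ := Polynomial.C (C : ℤ) *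
      (1 + Polynomial.C (∑ i, v i ^ 2) * Polynomial.X ^ 2) ^ D with hQ
    have hQdeg : Q.natDegree ≤ 2 * D := by
      rw [hQ]; compute_degree; omega
    have hfin := Polynomial.finite_abs_eval_le_of_degree_lt
      (Polynomial.degree_lt_degree (lt_of_le_of_lt hQdeg hlt))
    refine Set.infinite_univ (α := ℤ) (hfin.subset fun m _ => ?_)
    have hm := h fun i => v i * m
    have hQm : ((Q.eval m : ℤ) : ℝ) =
        C * (1 + ∑ i, (((v i * m : ℤ)) : ℝ) ^ 2) ^ D := by
      simp [hQ, mul_pow, Finset.sum_mul, Polynomial.eval_finsetSum]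
    rw [← hQm, ← eval_restrictLine] at hm
    have : |(restrictLine v P).eval m| ≤ Q.eval m := by exact_mod_cast hm
    exact this.trans (le_abs_self _)
  refine Finset.sup_le fun b hb => ?_
  by_contra! hlt
  have h0 := congrArg (coeff b) (key _ hlt)
  rw [coeff_homogeneousComponent, if_pos (by rfl), coeff_zero] at h0
  exact mem_support_iff.1 hb h0

/-- Growth forces degree at most `2 * D`, so `P` is determined by its values on a grid with `2 * D +
1` points per side. These are integers in bounded intervals. -/
lemma finite_setOf_abs_eval_le {H : (σ → ℤ) → ℝ} (hH : HasPolynomialGrowth H) :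
    {P : MvPolynomial σ ℤ | ∀ τ, |((eval τ P : ℤ) : ℝ)| ≤ H τ}.Finite := by
  classical
  obtain ⟨C, D, hCD⟩ := hH
  let grid : Finset (σ → ℤ) := Fintype.piFinset fun _ => Finset.Icc 0 (2 * D : ℤ)
  have hfin : (Set.univ.pi fun τ : grid => Set.Icc (-⌈H τ⌉) ⌈H τ⌉).Finite :=
    Set.Finite.pi fun τ => Set.finite_Icc _ _
  refine Set.Finite.of_finite_image (f := fun P (τ : grid) => eval τ.1 P)
    (hfin.subset ?_) ?_
  · rintro _ ⟨P, hP, rfl⟩ τ _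
    have := hP τ
    rw [Set.mem_Icc, ← abs_le]
    exact_mod_cast this.trans (Int.le_ceil _)
  · intro P hP Q hQ hPQ
    have hdeg : ∀ P ∈ {P : MvPolynomial σ ℤ | ∀ τ, |((eval τ P : ℤ) : ℝ)| ≤ H τ},
        P.totalDegree ≤ 2 * D :=
      fun P hP => totalDegree_le_of_growth fun τ => (hP τ).trans (hCD τ)
    rw [← sub_eq_zero]
    apply eq_zero_of_eval_zero_at_prod_finset (P - Q) fun _ => Finset.Icc 0 (2 * D : ℤ)
    · intro i
      have h1 := (degreeOf_le_totalDegree (P - Q) i).trans (totalDegree_sub P Q)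
      have h2 := hdeg P hP
      have h3 := hdeg Q hQ
      simp only [Int.card_Icc]
      omega
    · intro τ hτ
      have := congrFun hPQ ⟨τ, Fintype.mem_piFinset.2 hτ⟩
      simpa [sub_eq_zero] using this

end MvPolynomial

/-! ### Radicals of finitely generated subgroups of finitely generated fields -/

/-- A ring homomorphism into an algebraically closed field extends to integral extensions. -/
theorem exists_ringHom_comp_algebraMap_eq_of_isIntegral {A B Ω : Type*} [CommRing A] [CommRing B]
    [Algebra A B] [Algebra.IsIntegral A B] [FaithfulSMul A B] [Field Ω] [IsAlgClosed Ω]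
    (φ : A →+* Ω) : ∃ Φ : B →+* Ω, Φ.comp (algebraMap A B) = φ := by
  have hP : (RingHom.ker φ).IsPrime := RingHom.ker_isPrime φ
  -- Lying over: `B ⧸ Q` is integral over `A ⧸ ker φ`, which embeds in `Ω`.
  obtain ⟨Q, hQ, hQP⟩ := (Ideal.nonempty_primesOver (S := B) (RingHom.ker φ)).some
  let φ' : A ⧸ RingHom.ker φ →+* Ω := RingHom.kerLift φ
  let : Algebra (A ⧸ RingHom.ker φ) Ω := φ'.toAlgebra
  have : FaithfulSMul (A ⧸ RingHom.ker φ) Ω :=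
    (faithfulSMul_iff_algebraMap_injective _ _).2 (RingHom.kerLift_injective φ)
  have : FaithfulSMul (A ⧸ RingHom.ker φ) (B ⧸ Q) := inferInstance
  have : IsDomain (A ⧸ RingHom.ker φ) := Ideal.Quotient.isDomain _
  have : IsDomain (B ⧸ Q) := Ideal.Quotient.isDomain _
  have : Algebra.IsIntegral (A ⧸ RingHom.ker φ) (B ⧸ Q) := inferInstance
  have : Module.IsTorsionFree (A ⧸ RingHom.ker φ) (B ⧸ Q) :=
    Module.isTorsionFree_iff_faithfulSMul.2 inferInstance
  have : Module.IsTorsionFree (A ⧸ RingHom.ker φ) Ω :=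
    Module.isTorsionFree_iff_faithfulSMul.2 inferInstance
  let Ψ : B ⧸ Q →ₐ[A ⧸ RingHom.ker φ] Ω := IsAlgClosed.lift
  refine ⟨Ψ.toRingHom.comp (Ideal.Quotient.mk Q), RingHom.ext fun x => ?_⟩
  exact Ψ.commutes (Ideal.Quotient.mk _ x)

section Northcott

variable {σ : Type*} {F : Type*} [Field F] [Algebra (MvPolynomial σ ℤ) F]

/-- Cauchy's bound for the roots of the specialisation at `τ` of the minimal polynomial of `x`. -/
noncomputable def conjugateBound (x : F) (τ : σ → ℤ) : ℝ :=
  ((minpoly (MvPolynomial σ ℤ) x).map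
    ((Int.castRingHom ℂ).comp (MvPolynomial.eval τ))).cauchyBound

lemma one_le_conjugateBound (x : F) (τ : σ → ℤ) : 1 ≤ conjugateBound x τ := by
  exact_mod_cast Polynomial.one_le_cauchyBound _

/-- The minimal polynomial is monic, so Cauchy's bound involves no division: it is at most one plus
the sum of the absolute values of the specialised coefficients. -/
lemma hasPolynomialGrowth_conjugateBound [Fintype σ] {x : F} (hx : IsIntegral (MvPolynomial σ ℤ) x) :
    HasPolynomialGrowth (conjugateBound (σ := σ) x) := by
  set p := minpoly (MvPolynomial σ ℤ) x
  refine ((HasPolynomialGrowth.sum (Finset.range p.natDegree) fun i _ =>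
    HasPolynomialGrowth.abs_eval (p.coeff i)).add (HasPolynomialGrowth.const 1)).mono fun τ => ?_
  have hp : p.Monic := minpoly.monic hx
  simp only [conjugateBound, Polynomial.cauchyBound]
  rw [hp.natDegree_map, (hp.map _).leadingCoeff]
  simp only [nnnorm_one, div_one, NNReal.coe_add, NNReal.coe_one]
  gcongr
  have : (Finset.range p.natDegree).sup (fun i => ‖(p.map ((Int.castRingHom ℂ).comp
      (MvPolynomial.eval τ))).coeff i‖₊) ≤ ∑ i ∈ Finset.range p.natDegree,
        ‖(p.map ((Int.castRingHom ℂ).comp (MvPolynomial.eval τ))).coeff i‖₊ :=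
    Finset.sup_le fun i hi => Finset.single_le_sum_of_canonicallyOrdered
      (f := fun i => ‖(p.map ((Int.castRingHom ℂ).comp (MvPolynomial.eval τ))).coeff i‖₊) hi
  refine (NNReal.coe_le_coe.2 this).trans (le_of_eq ?_)
  push_cast
  refine Finset.sum_congr rfl fun i _ => ?_
  simp [Polynomial.coeff_map]

variable [Algebra (FractionRing (MvPolynomial σ ℤ)) F]
  [IsScalarTower (MvPolynomial σ ℤ) (FractionRing (MvPolynomial σ ℤ)) F]
  [FiniteDimensional (FractionRing (MvPolynomial σ ℤ)) F]

/-- If `y ^ n` is a product of powers of integral elements `α i` with exponents at most `n`, then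
the specialisations of the conjugates of `y` are bounded independently of `n`. -/
lemma norm_le_of_isRoot_map_minpoly {ι : Type*} [Fintype ι] {α : ι → F}
    (hα : ∀ i, IsIntegral (MvPolynomial σ ℤ) (α i)) {y : F}
    (hy : IsIntegral (MvPolynomial σ ℤ) y) {n : ℕ} (hn : 0 < n) {e : ι → ℕ} (he : ∀ i, e i ≤ n)
    (hye : y ^ n = ∏ i, α i ^ e i) (τ : σ → ℤ) {z : ℂ}
    (hz : ((minpoly (MvPolynomial σ ℤ) y).map
      ((Int.castRingHom ℂ).comp (MvPolynomial.eval τ))).IsRoot z) :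
    ‖z‖ ≤ ∏ i, conjugateBound (σ := σ) (α i) τ := by
  set A := MvPolynomial σ ℤ
  set k := FractionRing A
  set φ : A →+* ℂ := (Int.castRingHom ℂ).comp (MvPolynomial.eval τ)
  let Ω := AlgebraicClosure F
  let B := integralClosure A Ω
  have : IsScalarTower A k Ω := IsScalarTower.of_algebraMap_eq fun x => by
    rw [IsScalarTower.algebraMap_apply A F Ω, IsScalarTower.algebraMap_apply A k F,
      ← IsScalarTower.algebraMap_apply k F Ω]
  have hinj : Function.Injective (algebraMap A Ω) := by
    rw [IsScalarTower.algebraMap_eq A k Ω]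
    exact (algebraMap k Ω).injective.comp (IsFractionRing.injective A k)
  have : FaithfulSMul A Ω := (faithfulSMul_iff_algebraMap_injective _ _).2 hinj
  have : FaithfulSMul A B := (faithfulSMul_iff_algebraMap_injective _ _).2
    (Function.Injective.of_comp (f := algebraMap B Ω) hinj)
  -- Extending the specialisation to `B` makes each root `z` the image of a true conjugate `r` of
  -- `y`.
  obtain ⟨Φ, hΦ⟩ := exists_ringHom_comp_algebraMap_eq_of_isIntegral (B := B) φ
  -- the minimal polynomial of `y` splits in `B`
  have hmonic := minpoly.monic hy
  have hsplit : ((minpoly A y).map (algebraMap A B)).Splits := by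
    refine Polynomial.Splits.of_splits_map_of_injective (i := algebraMap B Ω)
      Subtype.val_injective (IsAlgClosed.splits _) fun a ha => ?_
    refine ⟨⟨a, minpoly A y, hmonic, ?_⟩, rfl⟩
    have := (Polynomial.mem_roots'.1 ha).2
    rwa [Polynomial.map_map, ← IsScalarTower.algebraMap_eq, Polynomial.IsRoot,
      Polynomial.eval_map] at this
  obtain ⟨r, hr, hrz⟩ : ∃ r : B, ((minpoly A y).map (algebraMap A B)).IsRoot r ∧ Φ r = z := by
    rw [← hΦ, ← Polynomial.map_map] at hz
    have h1 := hsplit.roots_map_of_ne_zero (φ := Φ) ((hmonic.map _).map _).ne_zero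
    have h2 : z ∈ (((minpoly A y).map (algebraMap A B)).map Φ).roots :=
      (Polynomial.mem_roots ((hmonic.map _).map _).ne_zero).2 hz
    rw [h1, Multiset.mem_map] at h2
    obtain ⟨r, hr, hrz⟩ := h2
    exact ⟨r, (Polynomial.mem_roots'.1 hr).2, hrz⟩
  -- `A` is integrally closed, so `minpoly A y` is also minimal over `k`, and `y ↦ r` extends to
  -- `F`. The embedding transports the relation `hye` to `r`.
  obtain ⟨g, hg⟩ : ∃ g : F →ₐ[k] Ω, g y = r := by
    refine IntermediateField.exists_algHom_of_splits_of_aeval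
      (fun s => ⟨Algebra.IsIntegral.isIntegral s, IsAlgClosed.splits _⟩) ?_
    rw [minpoly.isIntegrallyClosed_eq_field_fractions' k hy, Polynomial.aeval_map_algebraMap]
    rw [Polynomial.IsRoot, Polynomial.eval_map_algebraMap] at hr
    rw [Subalgebra.aeval_coe, hr, Subalgebra.coe_zero]
  have hgint : ∀ i, IsIntegral A (g (α i)) := fun i => (hα i).map (g.restrictScalars A)
  let β : ι → B := fun i => ⟨g (α i), hgint i⟩
  have hrn : r ^ n = ∏ i, β i ^ e i := by
    apply Subtype.val_injective
    have := congrArg g hye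
    simpa [β, hg] using this
  have hβ : ∀ i, ‖Φ (β i)‖ ≤ conjugateBound (σ := σ) (α i) τ := by
    intro i
    have hroot : ((minpoly A (α i)).map φ).IsRoot (Φ (β i)) := by
      rw [← hΦ, ← Polynomial.map_map, Polynomial.IsRoot, Polynomial.eval_map,
        Polynomial.eval₂_hom, Polynomial.eval_map_algebraMap]
      have : Polynomial.aeval (β i) (minpoly A (α i)) = 0 := by
        apply Subtype.val_injective
        have h3 : Polynomial.aeval (g (α i)) (minpoly A (α i)) = 0 := by
          have := Polynomial.aeval_algHom_apply (g.restrictScalars A) (α i) (minpoly A (α i))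
          simpa using this
        rw [Subalgebra.coe_zero, ← h3]
        exact (Subalgebra.aeval_coe B (β i) _).symm
      rw [this, map_zero]
    have := hroot.norm_lt_cauchyBound ((minpoly.monic (hα i)).map φ).ne_zero
    exact_mod_cast this.le
  -- Each bound is at least `1`, so the exponents `e i ≤ n` may be raised to `n`; the `n`-th root
  -- then removes `n`.
  have hbound : ‖z‖ ^ n ≤ (∏ i, conjugateBound (σ := σ) (α i) τ) ^ n := by
    rw [← hrz, ← norm_pow, ← map_pow, hrn, map_prod, norm_prod, ← Finset.prod_pow]
    refine Finset.prod_le_prod (fun _ _ => norm_nonneg _) fun i _ => ?_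
    rw [map_pow, norm_pow]
    exact (pow_le_pow_left₀ (norm_nonneg _) (hβ i) _).trans
      (pow_le_pow_right₀ (one_le_conjugateBound _ _) (he i))
  exact le_of_pow_le_pow_left₀ hn.ne' (Finset.prod_nonneg fun i _ =>
    zero_le_one.trans (one_le_conjugateBound _ _)) hbound

/-- There are only finitely many integral elements with a power that is a product of powers of
given integral elements with no larger exponents. -/
theorem finite_setOf_pow_eq_prod_pow [Fintype σ] {ι : Type*} [Fintype ι] {α : ι → F}
    (hα : ∀ i, IsIntegral (MvPolynomial σ ℤ) (α i)) :
    {y : F | IsIntegral (MvPolynomial σ ℤ) y ∧ ∃ n : ℕ, 0 < n ∧ ∃ e : ι → ℕ, (∀ i, e i ≤ n) ∧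
      y ^ n = ∏ i, α i ^ e i}.Finite := by
  classical
  set A := MvPolynomial σ ℤ
  set k := FractionRing A
  set d := Module.finrank k F
  have h0 : ∀ i τ, 0 ≤ conjugateBound (σ := σ) (α i) τ := fun i τ =>
    zero_le_one.trans (one_le_conjugateBound _ _)
  -- This is the bound of `Polynomial.coeff_bdd_of_roots_le` on the coefficients of a monic
  -- polynomial in terms of its roots.
  have hgrowth : HasPolynomialGrowth (σ := σ) fun τ =>
      (max (∏ i, conjugateBound (σ := σ) (α i) τ) 1) ^ d * d.choose (d / 2) := by
    have h1 : HasPolynomialGrowth (σ := σ) fun τ => ∏ i, conjugateBound (σ := σ) (α i) τ :=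
      HasPolynomialGrowth.prod _ (fun i _ => hasPolynomialGrowth_conjugateBound (hα i)) h0
    have h2 : HasPolynomialGrowth (σ := σ) fun τ =>
        max (∏ i, conjugateBound (σ := σ) (α i) τ) 1 :=
      (h1.add (HasPolynomialGrowth.const 1)).mono fun τ => by
        have : 0 ≤ ∏ i, conjugateBound (σ := σ) (α i) τ := Finset.prod_nonneg fun i _ => h0 i τ
        exact max_le (by linarith) (by linarith)
    exact (h2.pow (fun τ => zero_le_one.trans (le_max_right _ _)) d).mul
      (HasPolynomialGrowth.const _) fun _ => Nat.cast_nonneg _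
  refine (Polynomial.bUnion_roots_finite (algebraMap A F) d
    (MvPolynomial.finite_setOf_abs_eval_le hgrowth)).subset ?_
  rintro y ⟨hy, n, hn, e, he, hye⟩
  simp only [Set.mem_iUnion]
  have hmonic := minpoly.monic hy
  have hdeg : (minpoly A y).natDegree ≤ d := by
    rw [← hmonic.natDegree_map (algebraMap A k), ← minpoly.isIntegrallyClosed_eq_field_fractions' k hy]
    exact minpoly.natDegree_le y
  refine ⟨minpoly A y, ⟨hdeg, fun i τ => ?_⟩, ?_⟩
  · have := Polynomial.coeff_bdd_of_roots_le ((Int.castRingHom ℂ).comp (MvPolynomial.eval τ))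
      hmonic (IsAlgClosed.splits _) hdeg (fun z hz => norm_le_of_isRoot_map_minpoly hα hy hn he hye τ
        (Polynomial.mem_roots'.1 hz).2) i
    simpa [Polynomial.coeff_map] using this
  · simp only [Finset.mem_coe, Multiset.mem_toFinset]
    rw [Polynomial.mem_roots (hmonic.map _).ne_zero, Polynomial.IsRoot,
      Polynomial.eval_map_algebraMap, minpoly.aeval]

end Northcott

lemma Subgroup.exists_prod_zpow_of_mem_closure_range {G ι : Type*} [CommGroup G] [Fintype ι]
    {γ : ι → G} {g : G} (hg : g ∈ Subgroup.closure (Set.range γ)) :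
    ∃ k : ι → ℤ, g = ∏ i, γ i ^ k i := by
  classical
  induction hg using Subgroup.closure_induction with
  | mem x hx =>
    obtain ⟨i, rfl⟩ := hx
    refine ⟨Pi.single i 1, ?_⟩
    rw [Finset.prod_eq_single i (fun j _ hj => by simp [hj]) (by simp)]
    simp
  | one => exact ⟨0, by simp⟩
  | mul x y _ _ hx hy =>
    obtain ⟨k, rfl⟩ := hx
    obtain ⟨l, rfl⟩ := hy
    exact ⟨k + l, by simp [zpow_add, Finset.prod_mul_distrib]⟩
  | inv x _ hx =>
    obtain ⟨k, rfl⟩ := hx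
    exact ⟨-k, by simp⟩

lemma subset_radicalHull {G : Type*} [CommGroup G] (A : Set G) : A ⊆ radicalHull A :=
  fun a ha => ⟨1, one_pos, by rw [pow_one]; exact Subgroup.subset_closure ha⟩

/-- Over a finite extension of a rational function field, the radical of a finitely generated
subgroup of the multiplicative group is finitely generated. -/
theorem fg_radicalHull_of_finiteDimensional {σ : Type*} [Finite σ]
    {F : Type*} [Field F] [Algebra (MvPolynomial σ ℤ) F]
    [Algebra (FractionRing (MvPolynomial σ ℤ)) F]
    [IsScalarTower (MvPolynomial σ ℤ) (FractionRing (MvPolynomial σ ℤ)) F]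
    [FiniteDimensional (FractionRing (MvPolynomial σ ℤ)) F]
    {ι : Type*} [Finite ι] (γ : ι → Fˣ) :
    (radicalHull (Set.range γ)).FG := by
  classical
  cases nonempty_fintype σ
  cases nonempty_fintype ι
  set A := MvPolynomial σ ℤ
  have hinj : Function.Injective (algebraMap A F) := by
    rw [IsScalarTower.algebraMap_eq A (FractionRing A) F]
    exact (algebraMap (FractionRing A) F).injective.comp (IsFractionRing.injective A _)
  have : FaithfulSMul A F := (faithfulSMul_iff_algebraMap_injective _ _).2 hinj
  have : Algebra.IsAlgebraic A F :=
    (IsFractionRing.comap_isAlgebraic_iff (K := FractionRing A)).2 inferInstance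
  obtain ⟨b, hb0, hb⟩ := Algebra.IsAlgebraic.exists_integral_multiples A
    (Finset.univ.image fun i => (γ i : F))
  have hb' : ∀ i, IsIntegral A (algebraMap A F b * γ i) := fun i => by
    rw [← Algebra.smul_def]; exact hb _ (by simp)
  set β : F := algebraMap A F b with hβ
  have hβ0 : β ≠ 0 := fun h => hb0 (hinj (by rw [← hβ, h, map_zero]))
  -- `β` clears denominators. If `u ^ n = ∏ γ i ^ e i` with `0 ≤ e i ≤ n`, then `(β ^ s * u) ^ n = ∏
  -- (β * γ i) ^ e i * β ^ (n - e i)`, with all exponents in `[0, n]`.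
  set α : ι ⊕ ι → F := Sum.elim (fun i => β * γ i) fun _ => β with hα
  have hαint : ∀ i, IsIntegral A (α i) := by
    rintro (i | i)
    · exact hb' i
    · exact isIntegral_algebraMap
  have hfin := finite_setOf_pow_eq_prod_pow hαint
  set s := Fintype.card ι
  set f : Fˣ → F := fun u => β ^ s * u
  have hf : Function.Injective f := fun u v huv =>
    Units.ext (mul_left_cancel₀ (pow_ne_zero s hβ0) huv)
  set T : Set Fˣ := (f ⁻¹' {y : F | IsIntegral A y ∧ ∃ n : ℕ, 0 < n ∧
    ∃ e : ι ⊕ ι → ℕ, (∀ i, e i ≤ n) ∧ y ^ n = ∏ i, α i ^ e i} ∩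
      radicalHull (Set.range γ)) ∪ Set.range γ
  refine (Subgroup.fg_iff _).2 ⟨T, le_antisymm ?_ ?_,
    ((hfin.preimage hf.injOn).inter_of_left _).union (Set.finite_range γ)⟩
  · rw [Subgroup.closure_le]
    refine Set.union_subset Set.inter_subset_right ?_
    rintro _ ⟨i, rfl⟩
    exact subset_radicalHull _ (Set.mem_range_self i)
  have hγT : ∀ i, γ i ∈ Subgroup.closure T := fun i =>
    Subgroup.subset_closure (Set.mem_union_right _ (Set.mem_range_self i))
  rintro y ⟨n, hn, hy⟩
  obtain ⟨k, hk⟩ := Subgroup.exists_prod_zpow_of_mem_closure_range hy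
  have hn' : (n : ℤ) ≠ 0 := by exact_mod_cast hn.ne'
  -- Modulo the group generated by `γ`, the exponents are reduced to their remainders mod `n`.
  set u : Fˣ := y * (∏ i, γ i ^ (k i / n))⁻¹ with hu
  set e : ι → ℕ := fun i => (k i % n).toNat with he
  have hecast : ∀ i, (e i : ℤ) = k i % n := fun i => Int.toNat_of_nonneg (Int.emod_nonneg _ hn')
  have hen : ∀ i, e i ≤ n := fun i => by
    have := Int.emod_lt_of_pos (k i) (show (0 : ℤ) < n by exact_mod_cast hn)
    have := hecast i
    omega
  have hun : u ^ n = ∏ i, γ i ^ e i := by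
    rw [hu, mul_pow, hk, inv_pow, ← Finset.prod_pow, ← Finset.prod_inv_distrib,
      ← Finset.prod_mul_distrib]
    refine Finset.prod_congr rfl fun i _ => ?_
    rw [← zpow_natCast (γ i) (e i), hecast, ← zpow_natCast (γ i ^ _), ← zpow_mul, ← zpow_neg,
      ← zpow_add]
    congr 1
    have := Int.emod_add_mul_ediv (k i) n
    linarith
  have hfu : f u ^ n = ∏ j, α j ^ (Sum.elim e fun i => n - e i) j := by
    rw [Fintype.prod_sum_type, ← Finset.prod_mul_distrib]
    simp only [hα, Sum.elim_inl, Sum.elim_inr, f, mul_pow]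
    have h1 : ∀ i, β ^ e i * (γ i : F) ^ e i * β ^ (n - e i) = β ^ n * ((γ i ^ e i : Fˣ) : F) := by
      intro i
      rw [mul_right_comm, ← pow_add, Nat.add_sub_cancel' (hen i), Units.val_pow_eq_pow_val]
    rw [Finset.prod_congr rfl fun i _ => h1 i, Finset.prod_mul_distrib, Finset.prod_const,
      Finset.card_univ, ← Units.coe_prod, ← hun, Units.val_pow_eq_pow_val, ← pow_mul, ← pow_mul,
      mul_comm n]
  have hint : IsIntegral A (f u) := by
    refine IsIntegral.of_pow hn ?_
    rw [hfu]
    exact IsIntegral.prod _ fun j _ => (hαint j).pow _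
  have hmem : u ∈ Subgroup.closure T := by
    refine Subgroup.subset_closure (Or.inl ⟨⟨hint, n, hn, _, ?_, hfu⟩, n, hn, ?_⟩)
    swap
    · rw [hun]
      exact Subgroup.prod_mem _ fun i _ =>
        Subgroup.pow_mem _ (Subgroup.subset_closure (Set.mem_range_self i)) _
    rintro (i | i)
    · exact hen i
    · exact Nat.sub_le _ _
  have hyu : y = u * ∏ i, γ i ^ (k i / n) := by rw [hu, inv_mul_cancel_right]
  rw [hyu]
  exact mul_mem hmem (Subgroup.prod_mem _ fun i _ => Subgroup.zpow_mem _ (hγT i) _)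

/-- In a field which is finitely generated over `ℚ`, the radical of a finitely generated subgroup
of the multiplicative group is finitely generated. -/
theorem fg_radicalHull (F : Type*) [Field F] [Algebra ℚ F]
    [Algebra.EssFiniteType ℚ F] {ι : Type*} [Finite ι] (γ : ι → Fˣ) :
    (radicalHull (Set.range γ)).FG := by
  have hchar : CharZero F := algebraRat.charZero F
  obtain ⟨S, hS⟩ := IntermediateField.fg_top ℚ F
  have halg : Algebra.IsAlgebraic (Algebra.adjoin ℤ (S : Set F)) F := by
    refine ⟨fun x => ?_⟩
    have hx : x ∈ IntermediateField.adjoin ℚ (S : Set F) := hS ▸ IntermediateField.mem_top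
    induction hx using IntermediateField.adjoin_induction with
    | mem x hx => exact isAlgebraic_algebraMap (⟨x, Algebra.subset_adjoin hx⟩ : Algebra.adjoin ℤ _)
    | algebraMap q =>
      have h1 : IsAlgebraic ℤ q :=
        (IsFractionRing.isAlgebraic_iff ℤ ℚ ℚ).2 (isAlgebraic_algebraMap q)
      exact (h1.algebraMap (A := F)).extendScalars
        (FaithfulSMul.algebraMap_injective ℤ (Algebra.adjoin ℤ (S : Set F)))
    | add x y _ _ hx hy => exact hx.add hy
    | inv x _ hx => exact hx.inv
    | mul x y _ _ hx hy => exact hx.mul hy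
  obtain ⟨t, htS, ht⟩ := exists_isTranscendenceBasis_subset (R := ℤ) (S : Set F)
  have : Finite t := S.finite_toSet.subset htS
  let : Algebra (MvPolynomial t ℤ) F := (MvPolynomial.aeval (fun i : t => (i : F))).toAlgebra
  have hinj : Function.Injective (algebraMap (MvPolynomial t ℤ) F) := ht.1
  have : FaithfulSMul (MvPolynomial t ℤ) F := (faithfulSMul_iff_algebraMap_injective _ _).2 hinj
  have halg' : Algebra.IsAlgebraic (MvPolynomial t ℤ) F := by
    have := ht.isAlgebraic
    exact Algebra.IsAlgebraic.of_ringHom_of_comp_eq ht.1.aevalEquiv (RingHom.id F)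
      ht.1.aevalEquiv.surjective Function.injective_id (RingHom.ext fun p => rfl)
  let : Algebra (FractionRing (MvPolynomial t ℤ)) F := FractionRing.liftAlgebra _ _
  have : IsScalarTower (MvPolynomial t ℤ) (FractionRing (MvPolynomial t ℤ)) F :=
    FractionRing.isScalarTower_liftAlgebra _ _
  have : Algebra.IsAlgebraic (FractionRing (MvPolynomial t ℤ)) F :=
    (IsFractionRing.comap_isAlgebraic_iff (A := MvPolynomial t ℤ)).1 inferInstance
  have : Algebra.EssFiniteType (FractionRing (MvPolynomial t ℤ)) F :=
    Algebra.EssFiniteType.of_comp ℚ _ _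
  have : FiniteDimensional (FractionRing (MvPolynomial t ℤ)) F :=
    Algebra.finite_of_essFiniteType_of_isAlgebraic
  exact fg_radicalHull_of_finiteDimensional (σ := t) γ

/-! ### Kummer theory over the field generated by all roots of unity -/

/-- Let `E` be obtained from `F` by adjoining all roots of unity, and assume that the roots of unity
in `F` are killed by `w`. If `x ^ n` lies in `F`, then `x ^ w` lies in `F` up to an `n`-th root of
unity. -/
theorem pow_mem_range_sup_rootsOfUnity {F E : Type*} [Field F] [CharZero F] [Field E] [Algebra F E]
    [IsCyclotomicExtension Set.univ F E] {w : ℕ}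
    (hw : ∀ u : Fˣ, IsOfFinOrder u → u ^ w = 1) {x : Eˣ} {n : ℕ} (hn : 0 < n)
    (hx : x ^ n ∈ (Units.map (algebraMap F E : F →* E)).range) :
    x ^ w ∈ (Units.map (algebraMap F E : F →* E)).range ⊔ rootsOfUnity n E := by
  have : NeZero n := ⟨hn.ne'⟩
  have : IsGalois F E := IsCyclotomicExtension.isGalois Set.univ F E
  have hcomm := IsCyclotomicExtension.isMulCommutative Set.univ F E
  set U := (Units.map (algebraMap F E : F →* E)).range
  have hfix : ∀ u : Eˣ, u ∈ U ↔ ∀ g : Gal(E/F), g • u = u := by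
    intro u
    constructor
    · rintro ⟨v, rfl⟩ g
      exact Units.ext (g.commutes v)
    · intro h
      obtain ⟨v, hv⟩ := (InfiniteGalois.mem_range_algebraMap_iff_fixed (k := F) (u : E)).2
        fun g => congrArg Units.val (h g)
      have hv0 : v ≠ 0 := fun h0 => u.ne_zero (by rw [← hv, h0, map_zero])
      exact ⟨Units.mk0 v hv0, Units.ext hv⟩
  -- The claim becomes `w ∈ H`. For the generator `d` of `H`, it suffices that a primitive `d`-th
  -- root of unity lies in `F`, for then `d ∣ w`.
  let H : AddSubgroup ℤ :=
    { carrier := {k | x ^ k ∈ U ⊔ rootsOfUnity n E}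
      zero_mem' := by simp
      add_mem' := fun {a b} ha hb => by
        rw [Set.mem_ofPred_eq, zpow_add]; exact mul_mem ha hb
      neg_mem' := fun {a} ha => by
        rw [Set.mem_ofPred_eq, zpow_neg]; exact inv_mem ha }
  obtain ⟨d, hd⟩ := Int.subgroup_cyclic H
  have hdvd : ∀ {k : ℤ}, k ∈ H ↔ d ∣ k := by
    intro k
    rw [hd, AddSubgroup.mem_closure_singleton]
    exact ⟨fun ⟨m, hm⟩ => ⟨m, by rw [← hm, smul_eq_mul, mul_comm]⟩,
      fun ⟨m, hm⟩ => ⟨m, by rw [hm, smul_eq_mul, mul_comm]⟩⟩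
  have hH : ∀ k : ℕ, (k : ℤ) ∈ H ↔ x ^ k ∈ U ⊔ rootsOfUnity n E := fun k => by
    rw [← zpow_natCast]; rfl
  have hnH : (n : ℤ) ∈ H := (hH n).2 (Subgroup.mem_sup_left hx)
  have hd0 : d.natAbs ≠ 0 := by
    intro h0
    have h1 := hdvd.1 hnH
    rw [Int.natAbs_eq_zero.1 h0, zero_dvd_iff] at h1
    exact hn.ne' (by exact_mod_cast h1)
  -- the Kummer cocycle of `x`
  obtain ⟨ζ, hζx⟩ : ∃ ζ : Gal(E/F) → Eˣ, ∀ g, g • x = ζ g * x :=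
    ⟨fun g => (g • x) * x⁻¹, fun g => by simp⟩
  have hζn : ∀ g, ζ g ∈ rootsOfUnity n E := by
    intro g
    have h1 := (hfix _).1 hx g
    rwa [smul_pow', hζx, mul_pow, mul_eq_right] at h1
  obtain ⟨ξ, hξ⟩ := IsCyclotomicExtension.exists_isPrimitiveRoot F E
    (Set.mem_univ d.natAbs) hd0
  let ξu : Eˣ := hξ.isUnit hd0 |>.unit
  have hξu : IsPrimitiveRoot ξu d.natAbs := hξ.isUnit_unit hd0
  have hdn : d.natAbs ∣ n := Int.natAbs_dvd_natAbs.2 (hdvd.1 hnH)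
  have hξn : ξu ∈ rootsOfUnity n E := by
    rw [mem_rootsOfUnity]
    exact (hξu.pow_eq_one_iff_dvd n).2 hdn
  have hξU : ξu ∈ U := by
    rw [hfix]
    intro g
    obtain ⟨m, hm⟩ := rootsOfUnity.integer_power_of_ringEquiv' n (g : E ≃+* E)
    have hm' : ∀ t ∈ rootsOfUnity n E, g • t = t ^ m := fun t ht => Units.ext (hm t ht)
    -- Computing `h • g • x = g • h • x` in both orders gives `h • ζ g = ζ h ^ (m - 1) * ζ g`, so `x
    -- ^ (m - 1) * (ζ g)⁻¹` is fixed by every `h`. Then `d ∣ m - 1`, and `g` fixes `ξu`.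
    have hmH : m - 1 ∈ H := by
      have hy : x ^ (m - 1) * (ζ g)⁻¹ ∈ U := by
        rw [hfix]
        intro h
        have hc : h • g • x = g • h • x := by
          rw [smul_smul, smul_smul, hcomm.is_comm.comm]
        rw [hζx g, smul_mul', hζx h, smul_mul', hζx g, hm' _ (hζn h)] at hc
        have hc' : h • ζ g = ζ h ^ (m - 1) * ζ g := by
          rw [← mul_left_inj (ζ h * x), hc, zpow_sub_one]
          simp only [mul_assoc, mul_left_comm]
          rw [mul_left_comm (ζ h) (ζ h ^ m), mul_inv_cancel_left]
        rw [smul_mul', smul_inv', hc', smul_zpow', hζx h, mul_zpow, mul_inv, mul_mul_mul_comm,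
          mul_inv_cancel, one_mul]
      have := mul_mem (Subgroup.mem_sup_left (T := rootsOfUnity n E) hy)
        (Subgroup.mem_sup_right (S := U) (hζn g))
      rwa [inv_mul_cancel_right] at this
    rw [hm' _ hξn]
    have h1 : ξu ^ (m - 1) = 1 :=
      (hξu.zpow_eq_one_iff_dvd _).2 (Int.natAbs_dvd.2 (hdvd.1 hmH))
    rwa [zpow_sub_one, mul_inv_eq_one] at h1
  obtain ⟨u, hu⟩ := hξU
  have hinj : Function.Injective (Units.map (algebraMap F E : F →* E)) :=
    Units.map_injective (algebraMap F E).injective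
  have huw : u ^ w = 1 := hw u (by
    rw [isOfFinOrder_iff_pow_eq_one]
    exact ⟨d.natAbs, Nat.pos_of_ne_zero hd0, hinj (by rw [map_pow, hu, hξu.pow_eq_one, map_one])⟩)
  have hdw : d.natAbs ∣ w := (hξu.pow_eq_one_iff_dvd w).1 (by rw [← hu, ← map_pow, huw, map_one])
  have hwH : (w : ℤ) ∈ H := hdvd.2 (Int.natAbs_dvd.1 (Int.natCast_dvd_natCast.2 hdw))
  exact (hH w).1 hwH

/-- The set of all complex roots of unity generates a cyclotomic extension of any subfield. -/
theorem isCyclotomicExtension_adjoin_univ (F : IntermediateField ℚ ℂ) :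
    IsCyclotomicExtension Set.univ F
      (IntermediateField.adjoin F {b : ℂ | ∃ n ∈ Set.univ, n ≠ 0 ∧ b ^ n = 1}) := by
  have h1 : IsCyclotomicExtension Set.univ F
      (Algebra.adjoin F {b : ℂ | ∃ n ∈ Set.univ, n ≠ 0 ∧ b ^ n = 1}) :=
    Algebra.isCyclotomicExtension_adjoin_of_exists_isPrimitiveRoot _ _ _
      fun n _ hn => ⟨_, Complex.isPrimitiveRoot_exp n hn⟩
  rw [← IntermediateField.adjoin_toSubalgebra_of_isAlgebraic] at h1
  · exact h1
  · rintro b ⟨n, -, hn, hb⟩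
    exact (IsIntegral.of_pow (Nat.pos_of_ne_zero hn) (hb ▸ isIntegral_one)).isAlgebraic

/-- The roots of unity in a field which is finitely generated over `ℚ` have bounded order. -/
theorem exists_pow_eq_one_of_isOfFinOrder (F : Type*) [Field F] [Algebra ℚ F]
    [Algebra.EssFiniteType ℚ F] :
    ∃ w : ℕ, 0 < w ∧ ∀ u : Fˣ, IsOfFinOrder u → u ^ w = 1 := by
  -- The roots of unity are the radical of the trivial group; a finitely generated torsion abelian
  -- group is finite, and `w` is its order.
  have hfg := fg_radicalHull F (fun i : Empty => (i.elim : Fˣ))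
  have hmem : ∀ u : Fˣ, u ∈ radicalHull (Set.range fun i : Empty => (i.elim : Fˣ)) ↔
      IsOfFinOrder u := by
    intro u
    rw [isOfFinOrder_iff_pow_eq_one, Set.range_eq_empty]
    refine exists_congr fun n => and_congr_right fun _ => ?_
    rw [Subgroup.closure_empty, Subgroup.mem_bot]
  have : Group.FG (radicalHull (Set.range fun i : Empty => (i.elim : Fˣ))) :=
    (Group.fg_iff_subgroup_fg _).2 hfg
  have hfin := CommGroup.finite_of_fg_isMulTorsion
    (radicalHull (Set.range fun i : Empty => (i.elim : Fˣ))) fun u =>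
      Submonoid.isOfFinOrder_coe.1 ((hmem u).1 u.2)
  refine ⟨_, Nat.card_pos
    (α := radicalHull (Set.range fun i : Empty => (i.elim : Fˣ))), fun u hu => ?_⟩
  exact congrArg Subtype.val (pow_card_eq_one' (x :=
    (⟨u, (hmem u).2 hu⟩ : radicalHull (Set.range fun i : Empty => (i.elim : Fˣ)))))

/-- Let `F` be a subfield of `ℂ` which is finitely generated over `ℚ`, and let `γ` be a finite
family in `F`. Up to roots of unity and a bounded power, the radical of `γ` inside the field `E`
obtained by adjoining all roots of unity to `F` is finitely generated. -/
theorem exists_pow_mem_rootsOfUnityGroup_sup {F : IntermediateField ℚ ℂ} (hF : F.FG)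
    (E : IntermediateField F ℂ) [IsCyclotomicExtension Set.univ F E]
    {ι : Type*} [Finite ι] (γ : ι → ℂˣ) (hγ : ∀ i, (γ i : ℂ) ∈ F) :
    ∃ w : ℕ, 0 < w ∧ ∃ G : Subgroup ℂˣ, G.FG ∧ ∀ x : ℂˣ, (x : ℂ) ∈ E →
      x ∈ radicalHull (Set.range γ) → x ^ w ∈ rootsOfUnityGroup ⊔ G := by
  have : Algebra.EssFiniteType ℚ F := IntermediateField.essFiniteType_iff.2 hF
  obtain ⟨w, hw0, hw⟩ := exists_pow_eq_one_of_isOfFinOrder F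
  let γ' : ι → Fˣ := fun i => Units.mk0 ⟨γ i, hγ i⟩ fun h => (γ i).ne_zero (congrArg Subtype.val h)
  let incl : Fˣ →* ℂˣ := Units.map (algebraMap F ℂ : F →* ℂ)
  have hinj : Function.Injective incl := Units.map_injective (algebraMap F ℂ).injective
  have hclosure : Subgroup.closure (Set.range γ) = (Subgroup.closure (Set.range γ')).map incl := by
    rw [MonoidHom.map_closure, ← Set.range_comp]
    congr 2
    funext i
    exact Units.ext rfl
  refine ⟨w, hw0, (radicalHull (Set.range γ')).map incl,
    ?_, ?_⟩
  · obtain ⟨S, hS⟩ := fg_radicalHull F γ'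
    exact (Subgroup.fg_iff _).2 ⟨incl '' S, by rw [← MonoidHom.map_closure, hS],
      S.finite_toSet.image _⟩
  rintro x hxE ⟨n, hn, hxn⟩
  let x' : Eˣ := Units.mk0 ⟨x, hxE⟩ fun h => x.ne_zero (congrArg Subtype.val h)
  obtain ⟨g, hg, hgx⟩ : x ^ n ∈ (Subgroup.closure (Set.range γ')).map incl := hclosure ▸ hxn
  have hx' : x' ^ n ∈ (Units.map (algebraMap F E : F →* E)).range := by
    refine ⟨g, Units.ext (Subtype.ext ?_)⟩
    exact congrArg Units.val hgx
  have key := pow_mem_range_sup_rootsOfUnity hw hn hx'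
  rw [Subgroup.mem_sup] at key
  obtain ⟨v, ⟨y, hy⟩, ζ, hζ, hyζ⟩ := key
  rw [← hy] at hyζ
  let ζ' : ℂˣ := Units.map (algebraMap E ℂ : E →* ℂ) ζ
  have hζ' : ζ' ^ n = 1 := by
    rw [← map_pow, (mem_rootsOfUnity _ _).1 hζ, map_one]
  have hxw : incl y * ζ' = x ^ w := Units.ext (congrArg (fun u : Eˣ => ((u : E) : ℂ)) hyζ)
  rw [← hxw, mul_comm]
  refine mul_mem (Subgroup.mem_sup_left ?_) (Subgroup.mem_sup_right ⟨y, ⟨n, hn, ?_⟩, rfl⟩)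
  · exact isOfFinOrder_iff_pow_eq_one.2 ⟨n, hn, hζ'⟩
  · have : y ^ n = g ^ w := hinj (by
      rw [map_pow, map_pow, hgx, ← pow_mul, mul_comm n, pow_mul, ← hxw, mul_pow, hζ', mul_one])
    rw [this]
    exact pow_mem hg w

/-! ### Nondegenerate solutions of linear equations with radical unknowns -/

/-- If a field `L` contains all roots of unity, then a nondegenerate solution of a unit equation over
`L` whose entries have a power in `L` has all its entries in `L`. -/
theorem IsNondegenerateSolution.mem_range_algebraMap {L : Type*} [Field L] [Algebra L ℂ]
    (hroots : ∀ ζ : ℂ, ∀ n : ℕ, 0 < n → ζ ^ n = 1 → ζ ∈ (algebraMap L ℂ).range)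
    {k : ℕ} {l : Fin k → ℂ} (hl : ∀ i, l i ∈ (algebraMap L ℂ).range) {x : Fin k → ℂˣ}
    (hx : ∀ i, ∃ n : ℕ, 0 < n ∧ (x i : ℂ) ^ n ∈ (algebraMap L ℂ).range)
    (h : IsNondegenerateSolution l x) (i : Fin k) : (x i : ℂ) ∈ (algebraMap L ℂ).range := by
  classical
  have : CharZero L := (RingHom.charZero_iff (algebraMap L ℂ).injective).2 inferInstance
  let Ω := algebraicClosure L ℂ
  have : IsGalois L Ω := ⟨⟩
  have hxΩ : ∀ i, (x i : ℂ) ∈ Ω := by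
    intro i
    obtain ⟨n, hn, y, hy⟩ := hx i
    exact mem_algebraicClosure_iff'.2 (IsIntegral.of_pow hn (hy ▸ isIntegral_algebraMap))
  choose l' hl' using hl
  have hx0 : ∀ i, (⟨x i, hxΩ i⟩ : Ω) ≠ 0 := fun i h0 => (x i).ne_zero (congrArg Subtype.val h0)
  -- A power of `x i` lies in `L`, so `g (x i) / x i` is a root of unity, hence in `L`. Being fixed
  -- by the Galois group, these factors are multiplicative in `g`.
  have hfixpow : ∀ i (g : Gal(Ω/L)), ∃ y : L,
      g ⟨x i, hxΩ i⟩ = algebraMap L Ω y * ⟨x i, hxΩ i⟩ := by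
    intro i g
    obtain ⟨n, hn, y, hy⟩ := hx i
    have hpow : (⟨x i, hxΩ i⟩ : Ω) ^ n = algebraMap L Ω y := Subtype.ext hy.symm
    have hz : (g ⟨x i, hxΩ i⟩ / ⟨x i, hxΩ i⟩) ^ n = 1 := by
      rw [div_pow, ← map_pow, hpow, g.commutes, ← hpow, div_self (pow_ne_zero n (hx0 i))]
    obtain ⟨z, hz'⟩ := hroots _ n hn (by exact_mod_cast congrArg Subtype.val hz :
      ((g ⟨x i, hxΩ i⟩ / ⟨x i, hxΩ i⟩ : Ω) : ℂ) ^ n = 1)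
    refine ⟨z, ?_⟩
    have : algebraMap L Ω z = g ⟨x i, hxΩ i⟩ / ⟨x i, hxΩ i⟩ := Subtype.ext hz'
    rw [this, div_mul_cancel₀ _ (hx0 i)]
  choose c hc using hfixpow
  let χ : Fin k → Gal(Ω/L) →* ℂ := fun i =>
    { toFun := fun g => algebraMap L ℂ (c i g)
      map_one' := by
        have h1 := hc i 1
        rw [AlgEquiv.one_apply, eq_comm, mul_eq_right₀ (hx0 i)] at h1
        exact congrArg Subtype.val h1
      map_mul' := fun g g' => by
        have h1 := hc i (g * g')
        rw [AlgEquiv.mul_apply, hc i g', map_mul, g.commutes, hc i g, ← mul_assoc, ← map_mul] at h1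
        have h2 := mul_right_cancel₀ (hx0 i) h1
        have h3 : algebraMap L ℂ (c i g' * c i g) = algebraMap L ℂ (c i (g * g')) :=
          congrArg Subtype.val h2
        rw [← h3, map_mul, mul_comm] }
  have hsum : ∀ g, ∑ j, l j * (x j : ℂ) * χ j g = 1 := by
    intro g
    have h1 : ∑ j, algebraMap L Ω (l' j) * (⟨x j, hxΩ j⟩ : Ω) = 1 := by
      apply Subtype.val_injective
      rw [OneMemClass.coe_one, ← h.1]
      push_cast
      refine Finset.sum_congr rfl fun j _ => ?_
      rw [← hl' j]
    have h2 := congrArg (fun z => ((g z : Ω) : ℂ)) h1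
    simp only [map_sum, map_mul, g.commutes, hc, map_one] at h2
    push_cast at h2
    rw [← h2]
    refine Finset.sum_congr rfl fun j _ => ?_
    rw [← hl' j]
    change _ * _ * algebraMap L ℂ (c j g) = algebraMap L ℂ (l' j) * (algebraMap L ℂ (c j g) * _)
    ring
  suffices hχ : χ i = 1 by
    have hfix : ∀ g : Gal(Ω/L), g ⟨x i, hxΩ i⟩ = ⟨x i, hxΩ i⟩ := by
      intro g
      have h1 : algebraMap L ℂ (c i g) = 1 := DFunLike.congr_fun hχ g
      have h2 : algebraMap L Ω (c i g) = 1 := Subtype.ext h1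
      rw [hc, h2, one_mul]
    obtain ⟨y, hy⟩ := (InfiniteGalois.mem_range_algebraMap_iff_fixed (k := L) _).2 hfix
    exact ⟨y, congrArg Subtype.val hy⟩
  by_contra hχ
  let s : Finset (Gal(Ω/L) →* ℂ) := insert 1 (Finset.univ.image χ)
  -- `hsum` regrouped as a linear relation between distinct characters, with the right-hand side `1`
  -- counted as the trivial character.
  let a : (Gal(Ω/L) →* ℂ) → ℂ := fun ψ =>
    (∑ j with χ j = ψ, l j * (x j : ℂ)) - if ψ = 1 then 1 else 0
  have hli := linearIndependent_iff'.1 (linearIndependent_monoidHom Gal(Ω/L) ℂ) s a (by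
    funext g
    rw [Finset.sum_apply]
    simp only [Pi.smul_apply, smul_eq_mul, a, sub_mul, Finset.sum_sub_distrib, ite_mul, one_mul,
      zero_mul, Pi.zero_apply]
    rw [Finset.sum_ite_eq' s 1, if_pos (Finset.mem_insert_self _ _), MonoidHom.one_apply,
      sub_eq_zero, ← hsum g, ← Finset.sum_fiberwise_of_maps_to (s := Finset.univ) (t := s) (g := χ)
        fun j _ => Finset.mem_insert_of_mem (Finset.mem_image_of_mem χ (Finset.mem_univ j))]
    refine Finset.sum_congr rfl fun ψ _ => ?_
    rw [Finset.sum_mul]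
    refine Finset.sum_congr rfl fun j hj => ?_
    rw [(Finset.mem_filter.1 hj).2]) (χ i)
    (Finset.mem_insert_of_mem (Finset.mem_image_of_mem χ (Finset.mem_univ i)))
  simp only [a, if_neg hχ, sub_zero] at hli
  -- The indices with character `χ i` form a vanishing subsum, proper because the full sum is `1`.
  refine h.2 _ ⟨i, by simp⟩ (fun huniv => ?_) hli
  rw [huniv, h.1] at hli
  exact one_ne_zero hli

/-! ### Logarithms of radical groups -/

lemma mem_rootsOfUnityGroup {u : ℂˣ} : u ∈ rootsOfUnityGroup ↔ ∃ n : ℕ, 0 < n ∧ u ^ n = 1 :=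
  isOfFinOrder_iff_pow_eq_one

/-- The exponential as a homomorphism to the multiplicative group of `ℂ`. -/
noncomputable def expUnitHom : ℂ →+ Additive ℂˣ where
  toFun z := Additive.ofMul (expUnit z)
  map_zero' := by
    rw [ofMul_eq_zero]
    exact Units.ext Complex.exp_zero
  map_add' z w := by
    rw [← ofMul_mul]
    exact congrArg _ (Units.ext (Complex.exp_add z w))

lemma expUnit_nsmul (n : ℕ) (z : ℂ) : expUnit (n • z) = expUnit z ^ n :=
  map_nsmul expUnitHom n z

lemma expUnit_sum_zsmul {ι : Type*} (s : Finset ι) (k : ι → ℤ) (z : ι → ℂ) :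
    expUnit (∑ i ∈ s, k i • z i) = ∏ i ∈ s, expUnit (z i) ^ k i := by
  have h := map_sum expUnitHom (fun i => k i • z i) s
  simp only [map_zsmul] at h
  exact h

/-- Every element of the radical group generated by the `exp (a i)` is, up to a root of unity, the
exponential of a rational linear combination of the `a i`. -/
lemma exists_expUnit_mul_of_mem_radicalHull {ι : Type*} [Fintype ι] {a : ι → ℂ} {x : ℂˣ}
    (hx : x ∈ radicalHull (Set.range fun i => expUnit (a i))) :
    ∃ v ∈ Submodule.span ℚ (Set.range a), ∃ ζ ∈ rootsOfUnityGroup, x = ζ * expUnit v := by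
  obtain ⟨n, hn, hxn⟩ := hx
  obtain ⟨k, hk⟩ := Subgroup.exists_prod_zpow_of_mem_closure_range hxn
  have hn' : (n : ℚ) ≠ 0 := by exact_mod_cast hn.ne'
  set v : ℂ := (n : ℚ)⁻¹ • ∑ i, k i • a i with hv
  have hvn : expUnit v ^ n = x ^ n := by
    rw [← expUnit_nsmul, hk, ← expUnit_sum_zsmul, hv, ← Nat.cast_smul_eq_nsmul ℚ, smul_smul,
      mul_inv_cancel₀ hn', one_smul]
  refine ⟨v, Submodule.smul_mem _ _ (Submodule.sum_mem _ fun i _ =>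
    zsmul_mem (Submodule.subset_span (Set.mem_range_self i)) _), x * (expUnit v)⁻¹, ?_, by simp⟩
  exact mem_rootsOfUnityGroup.2 ⟨n, hn, by rw [mul_pow, inv_pow, hvn, mul_inv_cancel]⟩

lemma linearIndependentOverIPi_iff {n : ℕ} {a : Fin n → ℂ} :
    LinearIndependentOverIPi a ↔ LinearIndependent ℚ a ∧
      Complex.I * (Real.pi : ℂ) ∉ Submodule.span ℚ (Set.range a) :=
  linearIndependent_finCons

/-- The logarithms of roots of unity are the rational multiples of `√-1 π`, so `exp` is injective on
`V` modulo `𝕌`. -/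
lemma eq_zero_of_expUnit_mem_rootsOfUnityGroup {V : Submodule ℚ ℂ}
    (hV : Complex.I * (Real.pi : ℂ) ∉ V) {v : ℂ} (hv : v ∈ V)
    (hexp : expUnit v ∈ rootsOfUnityGroup) : v = 0 := by
  obtain ⟨n, hn, hvn⟩ := mem_rootsOfUnityGroup.1 hexp
  rw [← expUnit_nsmul] at hvn
  obtain ⟨m, hm⟩ := Complex.exp_eq_one_iff.1 (congrArg Units.val hvn : Complex.exp (n • v) = 1)
  have hn' : (n : ℂ) ≠ 0 := by exact_mod_cast hn.ne'
  have hn'' : (n : ℚ) ≠ 0 := by exact_mod_cast hn.ne'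
  have hvm : v = ((2 * m / n : ℚ)) • (Complex.I * (Real.pi : ℂ)) := by
    rw [nsmul_eq_mul] at hm
    rw [Rat.smul_def]
    push_cast
    field_simp
    linear_combination hm
  by_cases hm0 : m = 0
  · rw [hvm, hm0]; simp
  · have hq : (2 * m / n : ℚ) ≠ 0 := div_ne_zero (mul_ne_zero two_ne_zero (by exact_mod_cast hm0)) hn''
    exact absurd ((V.smul_mem_iff hq).1 (hvm ▸ hv)) hV

/-- Let `V` be a `ℚ`-subspace of `ℂ` not containing `√-1 π`. The elements of `V` whose exponential
has its `w`-th power in a group which is finitely generated up to roots of unity form a finitely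
generated group, generated by a family which is linearly independent over `√-1 π`. -/
theorem exists_linearIndependentOverIPi_generators {V : Submodule ℚ ℂ}
    (hV : Complex.I * (Real.pi : ℂ) ∉ V) {w : ℕ} (hw : 0 < w) {G : Subgroup ℂˣ} (hG : G.FG) :
    ∃ (t : ℕ) (c : Fin t → ℂ), (∀ j, c j ∈ V) ∧ LinearIndependentOverIPi c ∧
      ∀ v ∈ V, expUnit v ^ w ∈ rootsOfUnityGroup ⊔ G →
        expUnit v ∈ Subgroup.closure (Set.range fun j => expUnit (c j)) := by
  obtain ⟨Q, _, π, hπ⟩ : ∃ (Q : Type) (_ : CommGroup Q) (π : ℂˣ →* Q),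
      π.ker = rootsOfUnityGroup :=
    ⟨ℂˣ ⧸ rootsOfUnityGroup, QuotientGroup.Quotient.commGroup _, QuotientGroup.mk' _,
      QuotientGroup.ker_mk' _⟩
  let f : ℂ →+ Additive Q := (w • MonoidHom.toAdditive π).comp expUnitHom
  have hf : ∀ v, f v = Additive.ofMul (π (expUnit v ^ w)) := fun v =>
    congrArg Additive.ofMul (map_pow π (expUnit v) w).symm
  let G' : AddSubgroup (Additive Q) := Subgroup.toAddSubgroup (G.map π)
  have hG' : ∀ v, f v ∈ G' ↔ expUnit v ^ w ∈ rootsOfUnityGroup ⊔ G := by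
    intro v
    rw [hf]
    change π (expUnit v ^ w) ∈ G.map π ↔ _
    rw [← Subgroup.mem_comap, Subgroup.comap_map_eq, hπ, sup_comm]
  have hG'fg : (AddSubgroup.toIntSubmodule G').FG := by
    rw [Submodule.fg_iff_addSubgroup_fg, AddSubgroup.toIntSubmodule_toAddSubgroup,
      ← Subgroup.fg_iff_add_fg]
    obtain ⟨S, rfl⟩ := hG
    exact (Subgroup.fg_iff _).2 ⟨π '' S, (MonoidHom.map_closure _ _).symm, S.finite_toSet.image _⟩
  -- The lattice of admissible logarithms. It embeds in the finitely generated group `G'`, and it is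
  -- torsion-free, hence free of finite rank.
  let Λ : Submodule ℤ ℂ :=
    V.restrictScalars ℤ ⊓ (AddSubgroup.toIntSubmodule G').comap f.toIntLinearMap
  have hΛ : ∀ v, v ∈ Λ ↔ v ∈ V ∧ expUnit v ^ w ∈ rootsOfUnityGroup ⊔ G := fun v =>
    and_congr Iff.rfl (hG' v)
  let F : Λ →ₗ[ℤ] AddSubgroup.toIntSubmodule G' :=
    (f.toIntLinearMap.comp Λ.subtype).codRestrict _ fun v => v.2.2
  have hF : Function.Injective F := by
    rw [injective_iff_map_eq_zero]
    intro v hv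
    have h1 : f v = 0 := congrArg Subtype.val hv
    rw [hf, ofMul_eq_zero, ← MonoidHom.mem_ker, hπ, ← expUnit_nsmul] at h1
    have h2 := eq_zero_of_expUnit_mem_rootsOfUnityGroup hV (V.nsmul_mem v.2.1 w) h1
    exact Subtype.ext ((smul_eq_zero.1 h2).resolve_left hw.ne')
  have : Module.Finite ℤ (AddSubgroup.toIntSubmodule G') := Module.Finite.iff_fg.2 hG'fg
  have : Module.Finite ℤ Λ := Module.Finite.of_injective F hF
  let b := Module.finBasis ℤ Λ
  refine ⟨_, fun j => (b j : ℂ), fun j => (b j).2.1, ?_, fun v hv hvw => ?_⟩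
  · rw [linearIndependentOverIPi_iff]
    constructor
    · rw [← LinearIndependent.iff_fractionRing ℤ ℚ]
      exact b.linearIndependent.map' Λ.subtype (Submodule.ker_subtype _)
    · exact fun h => hV (Submodule.span_le.2 (by rintro _ ⟨j, rfl⟩; exact (b j).2.1) h)
  · have h1 := congrArg Subtype.val (b.sum_repr ⟨v, (hΛ v).2 ⟨hv, hvw⟩⟩)
    rw [AddSubmonoidClass.coe_finsetSum] at h1
    have h2 : ∑ j, b.repr ⟨v, (hΛ v).2 ⟨hv, hvw⟩⟩ j • (b j : ℂ) = v := h1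
    rw [← h2, expUnit_sum_zsmul]
    exact Subgroup.prod_mem _ fun j _ =>
      Subgroup.zpow_mem _ (Subgroup.subset_closure (Set.mem_range_self j)) _

/-! ### The main theorem -/

lemma mem_cyclotomicClosure_of_pow_eq_one {ζ : ℂ} {n : ℕ} (hn : 0 < n) (hζ : ζ ^ n = 1) :
    ζ ∈ cyclotomicClosure := by
  have h0 : ζ ≠ 0 := fun h => by simp [h, hn.ne'] at hζ
  refine IntermediateField.subset_adjoin _ _ ⟨Units.mk0 ζ h0, ?_, rfl⟩
  exact mem_rootsOfUnityGroup.2 ⟨n, hn, Units.ext (by simpa using hζ)⟩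

/-- A finitely generated extension of `ℚ(𝕌)` is contained in the extension generated by the roots of
unity over a finitely generated extension of `ℚ`, which may be assumed to contain a given finite
set. -/
lemma exists_fg_le_adjoin_roots {L : IntermediateField cyclotomicClosure ℂ} (hL : L.FG)
    {A : Set ℂ} (hA : A.Finite) :
    ∃ F : IntermediateField ℚ ℂ, F.FG ∧ A ⊆ F ∧ ∀ z ∈ L,
      z ∈ IntermediateField.adjoin F {b : ℂ | ∃ n ∈ Set.univ, n ≠ 0 ∧ b ^ n = 1} := by
  obtain ⟨S, rfl⟩ := hL
  have hfin := S.finite_toSet.union hA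
  refine ⟨IntermediateField.adjoin ℚ (S ∪ A), IntermediateField.fg_adjoin_of_finite hfin,
    Set.subset_union_right.trans (IntermediateField.subset_adjoin _ _), fun z hz => ?_⟩
  set F := IntermediateField.adjoin ℚ (S ∪ A : Set ℂ)
  set E := IntermediateField.adjoin F {b : ℂ | ∃ n ∈ Set.univ, n ≠ 0 ∧ b ^ n = 1}
  induction hz using IntermediateField.adjoin_induction with
  | mem z hz =>
    exact E.algebraMap_mem ⟨z, IntermediateField.subset_adjoin ℚ _ (Set.mem_union_left _ hz)⟩
  | algebraMap q =>
    have hle : cyclotomicClosure ≤ E.restrictScalars ℚ := by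
      refine IntermediateField.adjoin_le_iff.2 ?_
      rintro _ ⟨u, hu, rfl⟩
      obtain ⟨n, hn, hun⟩ := mem_rootsOfUnityGroup.1 hu
      exact IntermediateField.subset_adjoin F _
        ⟨n, Set.mem_univ n, hn.ne', congrArg Units.val hun⟩
    exact hle q.2
  | add x y _ _ hx hy => exact add_mem hx hy
  | inv x _ hx => exact inv_mem hx
  | mul x y _ _ hx hy => exact mul_mem hx hy

theorem mainTheorem4
    (K : Subfield ℂ) (hKclosed : IsAlgClosed K)
    (hKtrdeg : Algebra.trdeg ℚ K < Cardinal.aleph0)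
    (hKpi : (Real.pi : ℂ) ∈ K)
    {s : ℕ} (a : Fin s → ℂ) (haK : ∀ i, a i ∈ K) (ha : LinearIndependentOverIPi a)
    (L : IntermediateField cyclotomicClosure ℂ) (hLfg : L.FG)
    (hLa : ∀ i, Complex.exp (a i) ∈ L) :
    ∃ (t : ℕ) (c : Fin t → ℂ), (∀ j, c j ∈ K) ∧ LinearIndependentOverIPi c ∧
      ∀ (k : ℕ) (l : Fin k → ℂ), (∀ i, l i ∈ L) →
        ∀ x : Fin k → ℂˣ,
          (∀ i, x i ∈ radicalHull (Set.range fun j => expUnit (a j))) →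
          IsNondegenerateSolution l x →
          ∀ i, x i ∈ rootsOfUnityGroup ⊔ Subgroup.closure (Set.range fun j => expUnit (c j)) := by
  obtain ⟨F, hF, haF, hLF⟩ := exists_fg_le_adjoin_roots hLfg
    (Set.finite_range fun i => Complex.exp (a i))
  have := isCyclotomicExtension_adjoin_univ F
  obtain ⟨w, hw, G, hG, hGx⟩ := exists_pow_mem_rootsOfUnityGroup_sup hF
    (IntermediateField.adjoin F {b : ℂ | ∃ n ∈ Set.univ, n ≠ 0 ∧ b ^ n = 1})
    (fun i => expUnit (a i)) fun i => haF (Set.mem_range_self i)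
  obtain ⟨t, c, hcV, hc, hgen⟩ :=
    exists_linearIndependentOverIPi_generators (linearIndependentOverIPi_iff.1 ha).2 hw hG
  refine ⟨t, c, fun j => ?_, hc, fun k l hl x hx hsol i => ?_⟩
  -- The `c j` are rational combinations of the `a i`.
  · refine Submodule.span_induction (p := fun z _ => z ∈ K) ?_ K.zero_mem
      (fun _ _ _ _ => K.add_mem) (fun q z _ hz => ?_) (hcV j)
    · rintro _ ⟨i, rfl⟩
      exact haK i
    · rw [Rat.smul_def]
      exact K.mul_mem (SubfieldClass.ratCast_mem K q) hz
  · have hrange : ∀ z : ℂ, z ∈ (algebraMap L ℂ).range ↔ z ∈ L := fun z =>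
      ⟨fun ⟨y, hy⟩ => hy ▸ y.2, fun hz => ⟨⟨z, hz⟩, rfl⟩⟩
    have hxL : (x i : ℂ) ∈ L := by
      rw [← hrange]
      refine hsol.mem_range_algebraMap (fun ζ n hn hζ => ?_) (fun i => (hrange _).2 (hl i))
        (fun i => ?_) i
      · exact (hrange ζ).2 (L.algebraMap_mem ⟨ζ, mem_cyclotomicClosure_of_pow_eq_one hn hζ⟩)
      · obtain ⟨n, hn, hxn⟩ := hx i
        refine ⟨n, hn, (hrange _).2 ?_⟩
        obtain ⟨m, hm⟩ := Subgroup.exists_prod_zpow_of_mem_closure_range hxn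
        rw [← Units.val_pow_eq_pow_val, hm, Units.coe_prod]
        refine prod_mem fun j _ => ?_
        rw [Units.val_zpow_eq_zpow_val]
        exact zpow_mem (hLa j) _
    obtain ⟨v, hv, ζ, hζ, hxv⟩ := exists_expUnit_mul_of_mem_radicalHull (hx i)
    rw [hxv]
    refine mul_mem (Subgroup.mem_sup_left hζ) (Subgroup.mem_sup_right (hgen v hv ?_))
    -- The factor `ζ ^ w` is a root of unity, so the membership passes from `x i ^ w` to `expUnit v
    -- ^ w`.
    have hxw := hGx (x i) (hLF _ hxL) (hx i)
    rw [hxv, mul_pow] at hxw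
    exact (Subgroup.mul_mem_cancel_left _ (Subgroup.mem_sup_left (pow_mem hζ w))).1 hxw
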